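/- Let $\eta(z)=q^{1/24}\prod_{n\ge 1}(1-q^n)$, $q=e^{2\pi i z}$, be the Dedekind eta function on the upper half plane $\mathbb{H}$, and put $$\psi(z)=\left(\frac{\eta(z)}{\eta(2z)}\right)^{24},\qquad \phi(z)=\frac{1}{\psi(z)}.$$ There are integers $s(n)$ and $b(n)$ $(n\ge 1)$ such that, for all $z\in\mathbb{H}$, $$\psi(z)=q^{-1}-24+\sum_{n=1}^\infty s(n)q^n,\qquad \phi(z)=\sum_{n=1}^\infty b(n)q^n,$$ and any complex coefficients $s(n)$, $b(n)$ with which these expansions hold on $\mathbb{H}$ satisfy, as $n\to\infty$, $$|s(n)|\sim \frac{1}{2n^{3/4}}\,e^{2\pi\sqrt{n}},\qquad b(n)\sim \frac{2^{1/4}}{8192}\,\frac{1}{n^{3/4}}\,e^{2\pi\sqrt{2n}}.$$ -/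

import Mathlib

open scoped UpperHalfPlane

noncomputable section

namespace LevelTwo

/-- The nome `q = e ^ (2 π i z)`. -/
def nome (z : ℍ) : ℂ := Complex.exp (2 * Real.pi * Complex.I * (z : ℂ))

/-- The Hauptmodul `ψ(z) = (η(z) / η(2z)) ^ 24` on the upper half plane. -/
def psi (z : ℍ) : ℂ := (ModularForm.eta (z : ℂ) / ModularForm.eta (2 * (z : ℂ))) ^ 24

/-- The Hauptmodul `φ = 1 / ψ` on the upper half plane. -/
def phi (z : ℍ) : ℂ := 1 / psi z

/-- `ψ(z) = q⁻¹ - 24 + ∑_{n ≥ 1} s(n) q ^ n` on the upper half plane, the series being convergent;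
the value `s 0` plays no role. -/
def IsPsiExpansion (s : ℕ → ℂ) : Prop :=
  ∀ z : ℍ, HasSum (fun n : ℕ => s (n + 1) * nome z ^ (n + 1)) (psi z - ((nome z)⁻¹ - 24))

/-- `φ(z) = ∑_{n ≥ 1} b(n) q ^ n` on the upper half plane, the series being convergent;
the value `b 0` plays no role. -/
def IsPhiExpansion (b : ℕ → ℂ) : Prop :=
  ∀ z : ℍ, HasSum (fun n : ℕ => b (n + 1) * nome z ^ (n + 1)) (phi z)

end LevelTwo

end

noncomputable section

namespace LevelTwo

open Complex Filter MeasureTheory Set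
open scoped Topology Real

/-! This is the circle method with a single dominant arc. A coefficient is the integral of the
function against `exp (-2πinz)` over a horizontal period at height `y`. If near `0` the function is
`A exp (2πiκ/z) + O(1)`, and elsewhere on the period it is smaller by a factor `exp (-c/y)`, then
the saddle point at height `y = √(κ/n)` decides the asymptotics (`isEquivalent_coeff`).

For `φ = q ∏ (1 + q^n)^24` the growth at `0` comes from `φ(z) = ψ(-1/(2z)) / 4096`, so `κ = 1/2` and
`A = 1/4096`. For `ψ` the pole at `∞` reappears at the equivalent cusp `1/2`. The translate `g(z) =
-ψ(z + 1/2) = q⁻¹ ∏ (1 + q^(2n+1))^24` moves that cusp to `0` and is invariant under `z ↦ -1/(4z)`,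
so `κ = 1/4` and `A = 1`. The translation changes only signs of coefficients, whence the absolute
value in the statement.

No other cusp needs analysis: both products have factors `1 + q^m`, so their modulus is largest on
the imaginary axis, and `norm_one_add_le` makes the loss away from it quantitative
(`exists_minor_bound`). -/

/-! ### Fourier coefficients and the saddle-point method -/

lemma integral_exp_int_mul {k : ℤ} (hk : k ≠ 0) :
    ∫ x : ℝ in (-1 / 2)..(1 / 2), cexp (2 * π * I * k * x) = 0 := by
  have hc : (2 * π * I * k : ℂ) ≠ 0 := by simp [hk, Real.pi_ne_zero]
  rw [integral_exp_mul_complex hc, div_eq_zero_iff, sub_eq_zero]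
  left
  rw [Complex.exp_eq_exp_iff_exists_int]
  exact ⟨k, by push_cast; ring⟩

lemma im_add_mul_I (x y : ℝ) : ((x : ℂ) + y * I).im = y := by simp

lemma norm_nome_pow (x y : ℝ) (n : ℕ) :
    ‖cexp (2 * π * I * (x + y * I)) ^ n‖ = rexp (-2 * π * y) ^ n := by
  rw [norm_pow, Complex.norm_exp]
  simp

lemma summable_norm_coeff {a : ℕ → ℂ} {F : ℂ → ℂ}
    (hF : ∀ z : ℂ, 0 < z.im → HasSum (fun n => a n * cexp (2 * π * I * z) ^ n) (F z))
    {y : ℝ} (hy : 0 < y) : Summable fun n => ‖a n‖ * rexp (-2 * π * y) ^ n := by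
  have := (hF ((0 : ℝ) + y * I) (by simpa using hy)).summable.norm
  refine this.congr fun n => ?_
  rw [norm_mul, norm_nome_pow]

lemma continuous_of_hasSum {a : ℕ → ℂ} {F : ℂ → ℂ}
    (hF : ∀ z : ℂ, 0 < z.im → HasSum (fun n => a n * cexp (2 * π * I * z) ^ n) (F z))
    {y : ℝ} (hy : 0 < y) : Continuous fun x : ℝ => F (x + y * I) := by
  have h : (fun x : ℝ => F (x + y * I)) =
      fun x : ℝ => ∑' n, a n * cexp (2 * π * I * (x + y * I)) ^ n := by
    ext x
    exact (hF _ (by simpa using hy)).tsum_eq.symm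
  rw [h]
  refine continuous_tsum (fun n => by fun_prop) (summable_norm_coeff hF hy) fun n x => ?_
  rw [norm_mul, norm_nome_pow]

/-- Orthogonality of characters. Termwise integration is justified by absolute convergence at `iy`,
since the modulus of each term depends only on the height. -/
lemma coeff_eq_integral {a : ℕ → ℂ} {F : ℂ → ℂ}
    (hF : ∀ z : ℂ, 0 < z.im → HasSum (fun n => a n * cexp (2 * π * I * z) ^ n) (F z))
    {y : ℝ} (hy : 0 < y) (n : ℕ) :
    ∫ x : ℝ in (-1 / 2)..(1 / 2), F (x + y * I) * cexp (-(2 * π * I * n * (x + y * I))) = a n := by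
  have key := intervalIntegral.hasSum_integral_of_dominated_convergence (μ := volume)
    (a := -1 / 2) (b := 1 / 2)
    (F := fun (m : ℕ) (x : ℝ) => a m * cexp (2 * π * I * (x + y * I)) ^ m *
      cexp (-(2 * π * I * n * (x + y * I))))
    (f := fun x : ℝ => F (x + y * I) * cexp (-(2 * π * I * n * (x + y * I))))
    (fun m _ => ‖a m‖ * rexp (-2 * π * y) ^ m * rexp (2 * π * n * y))
    (fun m => by
      apply Continuous.aestronglyMeasurable
      fun_prop)
    (fun m => .of_forall fun x _ => by
      rw [norm_mul, norm_mul, norm_nome_pow, Complex.norm_exp]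
      simp)
    (.of_forall fun x _ => (summable_norm_coeff hF hy).mul_right _)
    (by simp)
    (.of_forall fun x _ => (hF _ (by simpa using hy)).mul_right _)
  refine key.unique ?_
  refine (congrArg (HasSum · (a n)) (funext fun m => ?_)).mpr (hasSum_ite_eq n (a n))
  have h1 : ∀ x : ℝ, a m * cexp (2 * π * I * (x + y * I)) ^ m *
      cexp (-(2 * π * I * n * (x + y * I))) =
      a m * cexp (2 * π * I * ((m - n : ℤ) : ℂ) * (y * I)) *
        cexp (2 * π * I * ((m - n : ℤ) : ℂ) * x) := by
    intro x
    rw [← Complex.exp_nat_mul, mul_assoc (a m), mul_assoc (a m), ← Complex.exp_add, ← Complex.exp_add]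
    congr 2
    push_cast
    ring
  simp_rw [h1]
  rw [intervalIntegral.integral_const_mul]
  split_ifs with hmn
  · subst hmn
    simp
    norm_num
  · rw [integral_exp_int_mul (by omega), mul_zero]

lemma re_neg_sq_div (u s : ℝ) : (-(u : ℂ) ^ 2 / (1 - s * I)).re = -u ^ 2 / (1 + s ^ 2) := by
  rw [Complex.div_re]
  simp [Complex.normSq_apply, ← Complex.ofReal_pow]
  ring

lemma one_sub_mul_I_ne_zero (s : ℝ) : (1 - s * I : ℂ) ≠ 0 := by
  intro h
  have := congrArg Complex.re h
  simp at this

/-- Substituting `u = t√N` turns the left side into an integral over `[-√N, √N]` whose integrand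
tends to `exp (-u²)`. -/
lemma tendsto_laplace :
    Tendsto (fun N : ℝ => (√N : ℂ) * ∫ t : ℝ in (-1)..1, cexp (-(N * t ^ 2) / (1 - t * I)))
      atTop (𝓝 (√π : ℂ)) := by
  have hlim : Tendsto (fun N : ℝ => ∫ u : ℝ, (Ioc (-√N) (√N)).indicator
      (fun u : ℝ => cexp (-(u : ℂ) ^ 2 / (1 - (u / √N : ℝ) * I))) u) atTop
      (𝓝 (∫ u : ℝ, cexp (-(u : ℂ) ^ 2))) := by
    -- On the range of integration `s = u/√N` has `s² ≤ 1`, so the real part `-u²/(1 + s²)` of the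
    -- exponent is at most `-u²/2`.
    refine tendsto_integral_filter_of_dominated_convergence (fun u => rexp (-(1 / 2) * u ^ 2))
      ?_ ?_ (integrable_exp_neg_mul_sq (by norm_num)) ?_
    · refine .of_forall fun N => ?_
      refine AEStronglyMeasurable.indicator ?_ measurableSet_Ioc
      apply Continuous.aestronglyMeasurable
      have : ∀ u : ℝ, (1 - (u / √N : ℝ) * I : ℂ) ≠ 0 := fun u => one_sub_mul_I_ne_zero _
      fun_prop (disch := exact this _)
    · filter_upwards [eventually_gt_atTop 0] with N hN
      refine .of_forall fun u => ?_
      by_cases hu : u ∈ Ioc (-√N) (√N)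
      · rw [indicator_of_mem hu, Complex.norm_exp, re_neg_sq_div]
        apply Real.exp_le_exp.2
        have hs : (u / √N) ^ 2 ≤ 1 := by
          rw [sq_le_one_iff_abs_le_one, abs_div, abs_of_pos (Real.sqrt_pos.2 hN),
            div_le_one (Real.sqrt_pos.2 hN)]
          exact abs_le.2 ⟨hu.1.le, hu.2⟩
        rw [div_le_iff₀ (by positivity)]
        nlinarith [sq_nonneg u, mul_nonneg (sq_nonneg u) (sub_nonneg.2 hs)]
      · rw [indicator_of_notMem hu, norm_zero]
        positivity
    · refine .of_forall fun u => ?_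
      have hev : ∀ᶠ N : ℝ in atTop, u ∈ Ioc (-√N) (√N) := by
        filter_upwards [Real.tendsto_sqrt_atTop.eventually_gt_atTop |u|] with N hN
        exact ⟨(abs_lt.1 hN).1, (abs_lt.1 hN).2.le⟩
      have h0 : Tendsto (fun N : ℝ => u / √N) atTop (𝓝 0) :=
        Real.tendsto_sqrt_atTop.const_div_atTop u
      have hc : ContinuousAt (fun s : ℝ => cexp (-(u : ℂ) ^ 2 / (1 - s * I))) 0 := by
        have := one_sub_mul_I_ne_zero 0
        fun_prop (disch := exact this)
      have h2 := hc.tendsto.comp h0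
      simp only [ofReal_zero, zero_mul, sub_zero, div_one] at h2
      refine h2.congr' ?_
      filter_upwards [hev] with N hN
      rw [indicator_of_mem hN]
      rfl
  have hg : ∫ u : ℝ, cexp (-(u : ℂ) ^ 2) = (√π : ℂ) := by
    have := integral_gaussian 1
    rw [div_one] at this
    rw [← this, ← integral_complex_ofReal]
    congr 1
    ext u
    push_cast
    ring_nf
  rw [hg] at hlim
  refine hlim.congr' ?_
  filter_upwards [eventually_gt_atTop 0] with N hN
  have hs : 0 < √N := Real.sqrt_pos.2 hN
  rw [integral_indicator measurableSet_Ioc, ← intervalIntegral.integral_of_le (by linarith)]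
  have := intervalIntegral.smul_integral_comp_mul_left (a := -1) (b := 1)
    (fun u : ℝ => cexp (-(u : ℂ) ^ 2 / (1 - (u / √N : ℝ) * I))) (√N)
  simp only [mul_neg, mul_one] at this
  rw [← this, real_smul]
  congr 1
  refine intervalIntegral.integral_congr fun t _ => ?_
  rw [mul_div_cancel_left₀ _ hs.ne']
  congr 2
  have : (N : ℂ) = (√N : ℂ) ^ 2 := by rw [← ofReal_pow, Real.sq_sqrt hN.le]
  rw [this]
  push_cast
  ring

/-- The two hypotheses say that `y = √(κ/n)` and `N = 2π√(κn)`. With `z = iy(1 - it)` the exponent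
is `N/(1 - it) + N(1 - it)`, which equals `2N - Nt²/(1 - it)` exactly, so no Taylor remainder
arises. -/
lemma saddle_exponent {κ y N : ℝ} {n : ℕ} (hy : 0 < y) (h1 : 2 * π * κ = N * y)
    (h2 : 2 * π * n * y = N) (t : ℝ) :
    cexp (2 * π * I * κ / ((y * t : ℝ) + y * I)) *
      cexp (-(2 * π * I * n * ((y * t : ℝ) + y * I))) =
    rexp (2 * N) * cexp (-(N * t ^ 2) / (1 - t * I)) := by
  rw [Complex.ofReal_exp, ← Complex.exp_add, ← Complex.exp_add]
  congr 1
  have ht := one_sub_mul_I_ne_zero t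
  have hyc : (y : ℂ) ≠ 0 := by exact_mod_cast hy.ne'
  have e1 : ((y * t : ℝ) + y * I : ℂ) = y * I * (1 - t * I) := by
    push_cast
    linear_combination (y * t : ℂ) * I_sq
  have h1' : (2 * π * κ : ℂ) = N * y := by exact_mod_cast h1
  have h2' : (2 * π * n * y : ℂ) = N := by exact_mod_cast h2
  have e2 : 2 * π * I * κ / (y * I * (1 - t * I)) = N / (1 - t * I) := by
    rw [div_eq_div_iff (mul_ne_zero (mul_ne_zero hyc I_ne_zero) ht) ht]
    linear_combination I * (1 - t * I) * h1'
  have e3 : 2 * π * I * n * (y * I * (1 - t * I)) = -N * (1 - t * I) := by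
    linear_combination I ^ 2 * (1 - t * I) * h2' + N * (1 - t * I) * I_sq
  rw [e1, e2, e3]
  push_cast
  field_simp
  linear_combination (N * t ^ 2 : ℂ) * I_sq

lemma norm_exp_neg_mul (n : ℕ) (x y : ℝ) :
    ‖cexp (-(2 * π * I * n * (x + y * I)))‖ = rexp (2 * π * n * y) := by
  rw [Complex.norm_exp]
  simp

/-- The period is cut at `x = ±y`. On the middle piece `F` is replaced by its model and `x = yt` is
substituted; the kernel has constant modulus `exp N` throughout. -/
lemma coeff_estimate {a : ℕ → ℂ} {F : ℂ → ℂ}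
    (hF : ∀ z : ℂ, 0 < z.im → HasSum (fun n => a n * cexp (2 * π * I * z) ^ n) (F z))
    {A κ B C y N : ℝ} {n : ℕ} (hy : 0 < y) (hy2 : y ≤ 1 / 2) (h1 : 2 * π * κ = N * y)
    (h2 : 2 * π * n * y = N)
    (hmajor : ∀ x : ℝ, |x| ≤ y → ‖F (x + y * I) - A * cexp (2 * π * I * κ / (x + y * I))‖ ≤ B)
    (hminor : ∀ x : ℝ, y ≤ |x| → |x| ≤ 1 / 2 → ‖F (x + y * I)‖ ≤ C) :
    ‖a n - A * rexp (2 * N) * y * ∫ t : ℝ in (-1)..1, cexp (-(N * t ^ 2) / (1 - t * I))‖ ≤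
      B * rexp N * (2 * y) + C * rexp N := by
  set f : ℝ → ℂ := fun x => F (x + y * I) * cexp (-(2 * π * I * n * (x + y * I))) with hf
  set g : ℝ → ℂ := fun x => A * cexp (2 * π * I * κ / (x + y * I)) *
    cexp (-(2 * π * I * n * (x + y * I))) with hg
  have hfc : Continuous f := (continuous_of_hasSum hF hy).mul (by fun_prop)
  have hgc : Continuous g := by
    have : ∀ x : ℝ, (x + y * I : ℂ) ≠ 0 := fun x h => by
      have := congrArg Complex.im h
      simp at this
      exact hy.ne' this
    fun_prop (disch := exact this _)
  have hgi : ∫ x in (-y)..y, g x = A * rexp (2 * N) * y *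
      ∫ t : ℝ in (-1)..1, cexp (-(N * t ^ 2) / (1 - t * I)) := by
    have := intervalIntegral.smul_integral_comp_mul_left (a := -1) (b := 1) g y
    simp only [mul_neg, mul_one] at this
    rw [← this, real_smul, mul_comm _ (y : ℂ), mul_assoc (y : ℂ),
      ← intervalIntegral.integral_const_mul (A * rexp (2 * N) : ℂ)]
    congr 1
    refine intervalIntegral.integral_congr fun t _ => ?_
    simp only [hg]
    rw [mul_assoc, saddle_exponent hy h1 h2, mul_assoc]
  have hfi : ∫ x in (-1 / 2)..(1 / 2), f x =
      (∫ x in (-1 / 2)..(-y), f x) + (∫ x in (-y)..y, f x) + ∫ x in y..(1 / 2), f x := by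
    rw [intervalIntegral.integral_add_adjacent_intervals,
      intervalIntegral.integral_add_adjacent_intervals] <;> exact hfc.intervalIntegrable _ _
  have hmid : ‖∫ x in (-y)..y, (f x - g x)‖ ≤ B * rexp N * (2 * y) := by
    have := intervalIntegral.norm_integral_le_of_norm_le_const (a := -y) (b := y)
      (f := fun x => f x - g x) (C := B * rexp N) fun x hx => by
        rw [uIoc_of_le (by linarith)] at hx
        rw [hf, hg, ← sub_mul, norm_mul, norm_exp_neg_mul, h2]
        exact mul_le_mul_of_nonneg_right (hmajor x (abs_le.2 ⟨hx.1.le, hx.2⟩)) (Real.exp_pos _).le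
    rwa [sub_neg_eq_add, ← two_mul, abs_of_pos (by linarith)] at this
  have hbd : ∀ x : ℝ, y ≤ |x| → |x| ≤ 1 / 2 → ‖f x‖ ≤ C * rexp N := fun x hx hx' => by
    rw [hf, norm_mul, norm_exp_neg_mul, h2]
    exact mul_le_mul_of_nonneg_right (hminor x hx hx') (Real.exp_pos _).le
  -- The minor bound at the endpoint `x = 1/2` forces nonnegativity; `y ≤ 1/2` makes that point
  -- admissible.
  have hC : 0 ≤ C * rexp N := (norm_nonneg _).trans
    (hbd (1 / 2) (by rwa [abs_of_pos (by norm_num)]) (by rw [abs_of_pos (by norm_num)]))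
  have hleft : ‖∫ x in (-1 / 2)..(-y), f x‖ ≤ C * rexp N * (1 / 2) := by
    refine (intervalIntegral.norm_integral_le_of_norm_le_const (C := C * rexp N)
      fun x hx => ?_).trans ?_
    · rw [uIoc_of_le (by linarith)] at hx
      have hx0 : x ≤ 0 := by linarith [hx.2]
      exact hbd x (by rw [abs_of_nonpos hx0]; linarith [hx.2])
        (by rw [abs_of_nonpos hx0]; linarith [hx.1])
    · refine mul_le_mul_of_nonneg_left ?_ hC
      rw [abs_of_nonneg (by linarith)]
      linarith
  have hright : ‖∫ x in y..(1 / 2), f x‖ ≤ C * rexp N * (1 / 2) := by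
    refine (intervalIntegral.norm_integral_le_of_norm_le_const (C := C * rexp N)
      fun x hx => ?_).trans ?_
    · rw [uIoc_of_le (by linarith)] at hx
      have hx0 : 0 ≤ x := by linarith [hx.1]
      exact hbd x (by rw [abs_of_nonneg hx0]; linarith [hx.1])
        (by rw [abs_of_nonneg hx0]; linarith [hx.2])
    · refine mul_le_mul_of_nonneg_left ?_ hC
      rw [abs_of_nonneg (by linarith)]
      linarith
  rw [intervalIntegral.integral_sub (hfc.intervalIntegrable _ _) (hgc.intervalIntegrable _ _)]
    at hmid
  rw [← coeff_eq_integral hF hy n, ← hgi]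
  change ‖(∫ x in (-1 / 2)..(1 / 2), f x) - _‖ ≤ _
  rw [hfi]
  calc _ = ‖((∫ x in (-y)..y, f x) - ∫ x in (-y)..y, g x) +
        ((∫ x in (-1 / 2)..(-y), f x) + ∫ x in y..(1 / 2), f x)‖ := by
        congr 1
        ring
    _ ≤ B * rexp N * (2 * y) + (C * rexp N * (1 / 2) + C * rexp N * (1 / 2)) :=
        (norm_add_le _ _).trans (add_le_add hmid ((norm_add_le _ _).trans (add_le_add hleft hright)))
    _ = _ := by ring

/-- If `F` is the sum of a Fourier series on the upper half plane which near the cusp `0` grows like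
`A * exp (2 π i κ / z)`, and is exponentially smaller on the rest of each horizontal period, then its
coefficients have the asymptotic growth given by the saddle point at `z = i √(κ / n)`. -/
theorem isEquivalent_coeff {a : ℕ → ℂ} {F : ℂ → ℂ}
    (hF : ∀ z : ℂ, 0 < z.im → HasSum (fun n => a n * cexp (2 * π * I * z) ^ n) (F z))
    {A κ B C c : ℝ} (hA : A ≠ 0) (hκ : 0 < κ) (hc : 0 < c)
    (hmajor : ∀ᶠ y : ℝ in 𝓝[>] 0, ∀ x : ℝ, |x| ≤ y →
      ‖F (x + y * I) - A * cexp (2 * π * I * κ / (x + y * I))‖ ≤ B)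
    (hminor : ∀ᶠ y : ℝ in 𝓝[>] 0, ∀ x : ℝ, y ≤ |x| → |x| ≤ 1 / 2 →
      ‖F (x + y * I)‖ ≤ C * rexp ((2 * π * κ - c) / y)) :
    Asymptotics.IsEquivalent atTop a
      (fun n : ℕ => ((A * κ ^ (1 / 4 : ℝ) / (√2 * (n : ℝ) ^ (3 / 4 : ℝ)) *
        rexp (4 * π * √(κ * n)) : ℝ) : ℂ)) := by
  have hN : Tendsto (fun n : ℕ => 2 * π * √(κ * n)) atTop atTop :=
    (Real.tendsto_sqrt_atTop.comp (tendsto_natCast_atTop_atTop.const_mul_atTop hκ)).const_mul_atTop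
      (by positivity)
  have hy : Tendsto (fun N : ℝ => 2 * π * κ / N) atTop (𝓝[>] 0) := by
    refine tendsto_nhdsWithin_iff.2 ⟨tendsto_id.const_div_atTop _, ?_⟩
    filter_upwards [eventually_gt_atTop 0] with N hN
    exact div_pos (by positivity) hN
  set J : ℝ → ℂ := fun N => ∫ t : ℝ in (-1)..1, cexp (-(N * t ^ 2) / (1 - t * I)) with hJ
  -- The main term `A exp (2N) y √(π/N)` with `y = 2πκ/N`.
  set M : ℝ → ℝ := fun N => A * (2 * π * κ) * √π * rexp (2 * N) / (N * √N) with hM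
  have hMn : ∀ᶠ n : ℕ in atTop, M (2 * π * √(κ * n)) =
      A * κ ^ (1 / 4 : ℝ) / (√2 * (n : ℝ) ^ (3 / 4 : ℝ)) * rexp (4 * π * √(κ * n)) := by
    filter_upwards [eventually_gt_atTop 0] with n hn
    have hn' : (0 : ℝ) < n := by exact_mod_cast hn
    have hs : 0 < √(κ * n) := Real.sqrt_pos.2 (by positivity)
    have e1 : √(κ * n) * √(√(κ * n)) = κ ^ (3 / 4 : ℝ) * (n : ℝ) ^ (3 / 4 : ℝ) := by
      rw [← Real.mul_rpow hκ.le hn'.le, Real.sqrt_eq_rpow, Real.sqrt_eq_rpow,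
        ← Real.rpow_mul (by positivity), ← Real.rpow_add (by positivity)]
      norm_num
    have e2 : κ = κ ^ (1 / 4 : ℝ) * κ ^ (3 / 4 : ℝ) := by
      rw [← Real.rpow_add hκ]
      norm_num
    have e3 : √(2 * π * √(κ * n)) = √2 * √π * √(√(κ * n)) := by
      rw [Real.sqrt_mul (by positivity), Real.sqrt_mul (by positivity)]
    have hk : 0 < κ ^ (3 / 4 : ℝ) := Real.rpow_pos_of_pos hκ _
    have hnk : 0 < (n : ℝ) ^ (3 / 4 : ℝ) := Real.rpow_pos_of_pos hn' _
    have hp := Real.sqrt_pos.2 Real.pi_pos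
    simp only [hM]
    rw [e3, show 2 * π * √(κ * n) * (√2 * √π * √(√(κ * n))) =
      2 * π * √2 * √π * (√(κ * n) * √(√(κ * n))) by ring, e1,
      show 2 * (2 * π * √(κ * n)) = 4 * π * √(κ * n) by ring]
    rw [div_mul_eq_mul_div, div_eq_div_iff (by positivity) (by positivity)]
    linear_combination (A * (2 * π) * √π * rexp (4 * π * √(κ * n)) * √2 * (n : ℝ) ^ (3 / 4 : ℝ)) * e2
  have hest : ∀ᶠ n : ℕ in atTop, ‖a n - A * rexp (2 * (2 * π * √(κ * n))) *
      (2 * π * κ / (2 * π * √(κ * n)) : ℝ) * J (2 * π * √(κ * n))‖ ≤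
      B * rexp (2 * π * √(κ * n)) * (2 * (2 * π * κ / (2 * π * √(κ * n)))) +
        C * rexp ((2 * π * κ - c) / (2 * π * κ / (2 * π * √(κ * n)))) *
          rexp (2 * π * √(κ * n)) := by
    have hy2 : ∀ᶠ y : ℝ in 𝓝[>] 0, y ≤ 1 / 2 :=
      (eventually_le_nhds (by norm_num)).filter_mono nhdsWithin_le_nhds
    filter_upwards [(hy.comp hN).eventually hmajor, (hy.comp hN).eventually hminor,
      (hy.comp hN).eventually hy2, eventually_gt_atTop 0] with n h1 h2 h3 hn
    have hn' : (0 : ℝ) < n := by exact_mod_cast hn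
    refine coeff_estimate hF (by positivity) h3 (by field_simp) ?_ h1 h2
    field_simp
    rw [Real.sq_sqrt (by positivity)]
  have hlim : Tendsto (fun n : ℕ => a n / (M (2 * π * √(κ * n)) : ℂ)) atTop (𝓝 1) := by
    have hmain : Tendsto (fun N : ℝ => (√N * J N) / (√π : ℂ)) atTop (𝓝 1) := by
      have h0 : (√π : ℂ) ≠ 0 := by
        exact_mod_cast (Real.sqrt_pos.2 Real.pi_pos).ne'
      have := tendsto_laplace.div_const (√π : ℂ)
      rwa [div_self h0] at this
    have herr : Tendsto (fun N : ℝ => (B * rexp N * (2 * (2 * π * κ / N)) +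
        C * rexp ((2 * π * κ - c) / (2 * π * κ / N)) * rexp N) / |M N|) atTop (𝓝 0) := by
      -- Relative to `M`, the major-arc error has size `√N exp (-N)` and the minor-arc error
      -- `N^(3/2) exp (-cN/(2πκ))`.
      have l1 := (tendsto_rpow_mul_exp_neg_mul_atTop_nhds_zero (1 / 2) 1 one_pos).const_mul
        (2 * B / (|A| * √π))
      have l2 := (tendsto_rpow_mul_exp_neg_mul_atTop_nhds_zero (3 / 2) (c / (2 * π * κ))
        (by positivity)).const_mul (C / (|A| * (2 * π * κ) * √π))
      have l3 := l1.add l2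
      rw [mul_zero, mul_zero, add_zero] at l3
      refine l3.congr' ?_
      filter_upwards [eventually_gt_atTop 0] with N hN
      have hs := Real.sqrt_pos.2 hN
      have hp := Real.sqrt_pos.2 Real.pi_pos
      have hA' : 0 < |A| := abs_pos.2 hA
      have r1 : N ^ (1 / 2 : ℝ) = √N := (Real.sqrt_eq_rpow N).symm
      have r2 : N ^ (3 / 2 : ℝ) = N * √N := by
        rw [Real.sqrt_eq_rpow, ← Real.rpow_one_add' hN.le (by norm_num)]
        norm_num
      have r3 : |M N| = |A| * (2 * π * κ) * √π * (rexp N * rexp N) / (N * √N) := by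
        simp only [hM]
        rw [abs_div, abs_mul, abs_mul, abs_mul, abs_of_pos (show 0 < 2 * π * κ by positivity),
          abs_of_pos hp, abs_of_pos (Real.exp_pos _), abs_of_pos (show 0 < N * √N by positivity),
          ← Real.exp_add, ← two_mul N]
      have r4 : rexp ((2 * π * κ - c) / (2 * π * κ / N)) =
          rexp N * rexp (-(c / (2 * π * κ)) * N) := by
        rw [← Real.exp_add]
        congr 1
        field_simp
        ring
      have r5 : rexp (-1 * N) = (rexp N)⁻¹ := by rw [← Real.exp_neg, neg_one_mul]
      rw [r1, r2, r3, r4, r5]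
      field_simp
    have hdiff : Tendsto (fun n : ℕ => a n / (M (2 * π * √(κ * n)) : ℂ) -
        (√(2 * π * √(κ * n)) * J (2 * π * √(κ * n))) / (√π : ℂ)) atTop (𝓝 0) := by
      refine squeeze_zero_norm' ?_ (herr.comp hN)
      filter_upwards [hest, hN.eventually_gt_atTop 0] with n hn hpos
      simp only [Function.comp_apply]
      set N := 2 * π * √(κ * n)
      have hMpos : 0 < |M N| := abs_pos.2 (by positivity)
      rw [le_div_iff₀ hMpos]
      refine le_trans (le_of_eq ?_) hn
      rw [← Complex.norm_real (M N) |>.trans (Real.norm_eq_abs _), ← norm_mul]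
      congr 1
      have hM0 : (M N : ℂ) ≠ 0 := by exact_mod_cast abs_pos.1 hMpos
      rw [sub_mul, div_mul_cancel₀ _ hM0]
      congr 1
      simp only [hM]
      have hs : (√N : ℂ) ≠ 0 := by exact_mod_cast (Real.sqrt_pos.2 hpos).ne'
      have hp : (√π : ℂ) ≠ 0 := by exact_mod_cast (Real.sqrt_pos.2 Real.pi_pos).ne'
      push_cast
      field_simp
    have := hdiff.add (hmain.comp hN)
    simpa using this
  refine (Asymptotics.isEquivalent_of_tendsto_one ?_).congr_right ?_ (v := fun n : ℕ => (M (2 * π * √(κ * n)) : ℂ))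
  · exact hlim
  · filter_upwards [hMn] with n hn
    rw [hn]

/-! ### Integral power series of the products -/

/-- The infinite product `∏ (1 + q ^ m i)`. -/
def onePlusProd (m : ℕ → ℕ) (q : ℂ) : ℂ := ∏' i, (1 + q ^ m i)

lemma summable_norm_pow {m : ℕ → ℕ} (hm : ∀ i, i + 1 ≤ m i) {q : ℂ} (hq : ‖q‖ < 1) :
    Summable fun i => ‖q ^ m i‖ := by
  refine (summable_geometric_of_lt_one (norm_nonneg q) hq).of_nonneg_of_le
    (fun _ => norm_nonneg _) fun i => ?_
  rw [norm_pow]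
  exact pow_le_pow_of_le_one (norm_nonneg q) hq.le (by have := hm i; omega)

/-- The function `f` is the sum on the unit disc of a power series `1 + k q + ⋯` with integer
coefficients. -/
def HasIntegralSeries (k : ℤ) (f : ℂ → ℂ) : Prop :=
  ∃ a : ℕ → ℤ, a 0 = 1 ∧ a 1 = k ∧ ∀ q : ℂ, ‖q‖ < 1 → HasSum (fun n => (a n : ℂ) * q ^ n) (f q)

lemma HasIntegralSeries.mul {k l : ℤ} {f g : ℂ → ℂ} (hf : HasIntegralSeries k f)
    (hg : HasIntegralSeries l g) : HasIntegralSeries (k + l) (fun q => f q * g q) := by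
  obtain ⟨a, a0, a1, ha⟩ := hf
  obtain ⟨b, b0, b1, hb⟩ := hg
  refine ⟨fun n => ∑ i ∈ Finset.range (n + 1), a i * b (n - i), by simp [a0, b0],
    by simp [Finset.sum_range_succ, a0, b0, a1, b1, add_comm], fun q hq => ?_⟩
  have := hasSum_sum_range_mul_of_summable_norm (ha q hq).summable.norm (hb q hq).summable.norm
  rw [(ha q hq).tsum_eq, (hb q hq).tsum_eq] at this
  refine (congrArg (HasSum · _) (funext fun n => ?_)).mpr this
  push_cast
  rw [Finset.sum_mul]
  refine Finset.sum_congr rfl fun i hi => ?_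
  rw [← Nat.add_sub_of_le (Finset.mem_range_succ_iff.1 hi), pow_add, Nat.add_sub_cancel_left]
  ring

lemma HasIntegralSeries.pow {k : ℤ} {f : ℂ → ℂ} (hf : HasIntegralSeries k f) (n : ℕ) :
    HasIntegralSeries (n * k) (fun q => f q ^ n) := by
  induction n with
  | zero =>
    refine ⟨fun n => if n = 0 then 1 else 0, by simp, by simp, fun q _ => ?_⟩
    have := hasSum_ite_eq (0 : ℕ) (1 : ℂ)
    refine (congrArg (HasSum · _) (funext fun n => ?_)).mpr (by simpa using this)
    split_ifs with h <;> simp [h]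
  | succ n ih =>
    have := ih.mul hf
    simp only [pow_succ]
    convert this using 1
    push_cast
    ring

/-- Expanding the product, the coefficient of `q^n` counts the finite index sets `s` with `∑ m i =
n`. The growth of `m` confines `s` to indices below `n`, so the count is finite. -/
lemma hasIntegralSeries_onePlusProd {m : ℕ → ℕ} (hm : ∀ i, i + 1 ≤ m i) (h0 : m 0 = 1) :
    HasIntegralSeries 1 (onePlusProd m) := by
  classical
  set S : ℕ → Finset (Finset ℕ) := fun n =>
    (Finset.range n).powerset.filter fun s => ∑ i ∈ s, m i = n with hS
  have hfib : ∀ n, (fun s : Finset ℕ => ∑ i ∈ s, m i) ⁻¹' {n} = (S n : Set (Finset ℕ)) := by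
    intro n
    ext s
    simp only [mem_preimage, mem_singleton_iff, hS, Finset.coe_filter, Finset.mem_powerset,
      mem_ofPred_eq, iff_and_self]
    rintro rfl i hi
    have := Finset.single_le_sum (f := m) (fun _ _ => Nat.zero_le _) hi
    have := hm i
    rw [Finset.mem_range]
    omega
  refine ⟨fun n => (S n).card, ?_, ?_, fun q hq => ?_⟩
  · have : S 0 = {∅} := by
      ext s
      simp only [hS, Finset.range_zero, Finset.powerset_empty, Finset.mem_filter,
        Finset.mem_singleton, and_iff_left_iff_imp]
      rintro rfl
      simp
    simp [this]
  · have : S 1 = {{0}} := by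
      ext s
      simp only [hS, Finset.range_one, Finset.mem_filter, Finset.mem_powerset,
        Finset.subset_singleton_iff, Finset.mem_singleton]
      constructor
      · rintro ⟨rfl | rfl, h⟩
        · simp at h
        · rfl
      · rintro rfl
        simp [h0]
    simp [this]
  · have hsum := summable_norm_pow hm hq
    have hs := summable_finsetProd_of_summable_norm hsum
    have h1 := hs.hasSum
    rw [← tprod_one_add hs] at h1
    have h2 := h1.tsum_fiberwise (fun s : Finset ℕ => ∑ i ∈ s, m i)
    refine (congrArg (HasSum · _) (funext fun n => ?_)).mpr h2
    rw [hfib, Finset.tsum_subtype' (S n) fun s : Finset ℕ => ∏ i ∈ s, q ^ m i]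
    rw [Finset.sum_congr rfl fun s hs => by
      rw [Finset.prod_pow_eq_pow_sum, (Finset.mem_filter.1 hs).2]]
    simp

/-- Since the constant term is `1`, the difference is again a power series, absolutely convergent at
`|q| = 1/2`. -/
lemma HasIntegralSeries.exists_bound {k : ℤ} {f : ℂ → ℂ} (hf : HasIntegralSeries k f) :
    ∃ C : ℝ, 0 ≤ C ∧ ∀ q : ℂ, q ≠ 0 → ‖q‖ ≤ 1 / 2 → ‖q⁻¹ * f q - q⁻¹‖ ≤ C := by
  obtain ⟨a, a0, -, ha⟩ := hf
  have hs : Summable fun n => ‖(a (n + 1) : ℂ)‖ * (1 / 2 : ℝ) ^ n := by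
    have := ((summable_nat_add_iff 1).2
      (ha (1 / 2 : ℂ) (by norm_num)).summable.norm).mul_right 2
    refine this.congr fun n => ?_
    rw [norm_mul, norm_pow, pow_succ]
    norm_num
    ring
  refine ⟨∑' n, ‖(a (n + 1) : ℂ)‖ * (1 / 2 : ℝ) ^ n, tsum_nonneg fun n => by positivity,
    fun q hq0 hq => ?_⟩
  have h1 := (hasSum_nat_add_iff' 1).2 (ha q (by linarith))
  simp only [Finset.range_one, Finset.sum_singleton, a0, pow_zero, Int.cast_one, mul_one] at h1
  have h2 : HasSum (fun n => (a (n + 1) : ℂ) * q ^ n) (q⁻¹ * f q - q⁻¹) := by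
    refine (congrArg₂ HasSum (funext fun n => ?_) ?_).mpr (h1.mul_left q⁻¹)
    · rw [pow_succ]
      field_simp
    · ring
  rw [← h2.tsum_eq]
  refine tsum_of_norm_bounded hs.hasSum fun n => ?_
  rw [norm_mul, norm_pow]
  gcongr

/-! ### Decay of the products away from the positive real axis -/

/-- With `d = |w| - Re w`, one has `|1 + w|² = (1 + |w|)² - 2d`. As `(1 + |w|)² ≤ 4`, this is at
most `(1 + |w|)² (1 - d/2) ≤ (1 + |w|)² exp (-d/2)`; the square root gives the constant `1/4`. -/
lemma norm_one_add_le {w : ℂ} (hw : ‖w‖ ≤ 1) :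
    ‖1 + w‖ ≤ (1 + ‖w‖) * rexp (-(1 / 4) * (‖w‖ - w.re)) := by
  have hre := Complex.re_le_norm w
  have hexp := Real.add_one_le_exp (-(1 / 2) * (‖w‖ - w.re))
  rw [← pow_le_pow_iff_left₀ (norm_nonneg _) (by positivity) two_ne_zero, mul_pow,
    ← Real.exp_nat_mul]
  have e : ((2 : ℕ) : ℝ) * (-(1 / 4) * (‖w‖ - w.re)) = -(1 / 2) * (‖w‖ - w.re) := by
    push_cast
    ring
  have h2 : ‖1 + w‖ ^ 2 = (1 + ‖w‖) ^ 2 - 2 * (‖w‖ - w.re) := by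
    have h3 : ‖w‖ ^ 2 = w.re ^ 2 + w.im ^ 2 := by
      rw [← Complex.normSq_eq_norm_sq, Complex.normSq_apply]
      ring
    rw [← Complex.normSq_eq_norm_sq, Complex.normSq_apply]
    simp
    linear_combination -h3
  rw [e, h2]
  have h0 := norm_nonneg w
  have h4 : (1 + ‖w‖) ^ 2 * (-(1 / 2) * (‖w‖ - w.re) + 1) ≤
      (1 + ‖w‖) ^ 2 * rexp (-(1 / 2) * (‖w‖ - w.re)) :=
    mul_le_mul_of_nonneg_left hexp (by positivity)
  nlinarith [mul_nonneg (sub_nonneg.2 hre) (show 0 ≤ 4 - (1 + ‖w‖) ^ 2 by nlinarith)]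

lemma norm_tprod_one_add_le {w : ℕ → ℂ} (hs : Summable fun n => ‖w n‖) (hw : ∀ n, ‖w n‖ ≤ 1) :
    ‖∏' n, (1 + w n)‖ ≤
      (∏' n, (1 + ‖w n‖)) * rexp (-(1 / 4) * ((∑' n, ‖w n‖) - (∑' n, w n).re)) := by
  have h1 := (multipliable_one_add_of_summable hs).hasProd.tendsto_prod_nat.norm
  have h2 := (Real.multipliable_one_add_of_summable hs).hasProd.tendsto_prod_nat
  have h3 := hs.hasSum.tendsto_sum_nat
  have h4 := (Complex.continuous_re.tendsto _).comp hs.of_norm.hasSum.tendsto_sum_nat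
  refine le_of_tendsto_of_tendsto' h1 (h2.mul (((h3.sub h4).const_mul (-(1 / 4))).rexp)) fun n => ?_
  rw [norm_prod, Function.comp_apply, Complex.re_sum, ← Finset.sum_sub_distrib, Finset.mul_sum,
    Real.exp_sum, ← Finset.prod_mul_distrib]
  exact Finset.prod_le_prod (fun _ _ => norm_nonneg _) fun i _ => norm_one_add_le (hw i)

lemma norm_onePlusProd_le {m : ℕ → ℕ} (hm : ∀ i, i + 1 ≤ m i) {q : ℂ} (hq : ‖q‖ < 1) :
    ‖onePlusProd m q‖ ≤ ‖onePlusProd m (‖q‖ : ℂ)‖ *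
      rexp (-(1 / 4) * ((∑' n, ‖q‖ ^ m n) - (∑' n, q ^ m n).re)) := by
  have h := norm_tprod_one_add_le (summable_norm_pow hm hq) fun n => by
    rw [norm_pow]
    exact pow_le_one₀ (norm_nonneg _) hq.le
  have hq' : ‖(‖q‖ : ℂ)‖ < 1 := by simpa using hq
  have h2 : ‖onePlusProd m (‖q‖ : ℂ)‖ = ∏' n, (1 + ‖q ^ m n‖) := by
    rw [onePlusProd,
      (multipliable_one_add_of_summable (summable_norm_pow hm hq')).norm_tprod]
    refine tprod_congr fun n => ?_
    rw [← ofReal_pow, ← ofReal_one, ← ofReal_add, Complex.norm_real, norm_pow,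
      Real.norm_of_nonneg (by positivity)]
  rw [h2]
  simpa only [norm_pow, onePlusProd] using h

lemma tsum_pow_succ {𝕜 : Type*} [NormedField 𝕜] [CompleteSpace 𝕜] {q : 𝕜} (hq : ‖q‖ < 1) :
    ∑' n : ℕ, q ^ (n + 1) = q / (1 - q) := by
  simp_rw [pow_succ]
  rw [tsum_mul_right, tsum_geometric_of_norm_lt_one hq]
  field_simp

lemma tsum_pow_odd {𝕜 : Type*} [NormedField 𝕜] [CompleteSpace 𝕜] {q : 𝕜} (hq : ‖q‖ < 1) :
    ∑' n : ℕ, q ^ (2 * n + 1) = q / (1 - q ^ 2) := by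
  have h : (fun n : ℕ => q ^ (2 * n + 1)) = fun n => (q ^ 2) ^ n * q := by
    ext n
    rw [pow_succ, pow_mul]
  rw [h, tsum_mul_right, tsum_geometric_of_norm_lt_one]
  · rw [div_eq_inv_mul]
  · rw [norm_pow]
    exact pow_lt_one₀ (norm_nonneg q) hq two_ne_zero

/-- With `r = |q|`, the bound on `Re q` gives `|1 - q|² ≥ (1 - r)² + 16ry²`, and `y²` dominates `(1
- r)²` up to a constant. Hence `|1 - q|² ≥ 1.1 (1 - r)²`, and the fixed proportion `1/11` of `r/(1 -
r)` is lost. -/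
lemma le_geometric_sub_re {q : ℂ} {y : ℝ} (hy : 0 < y) (hq : ‖q‖ < 1) (hqy : 1 - ‖q‖ ≤ 2 * π * y)
    (hq2 : 1 / 2 ≤ ‖q‖ ^ 2) (hre : q.re ≤ ‖q‖ * (1 - 8 * y ^ 2)) :
    1 / (88 * π * y) ≤ ‖q‖ / (1 - ‖q‖) - (q / (1 - q)).re := by
  set r := ‖q‖
  have hr0 : 0 ≤ r := norm_nonneg q
  have hr : r ^ 2 = q.re ^ 2 + q.im ^ 2 := by
    rw [← Complex.normSq_eq_norm_sq, Complex.normSq_apply]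
    ring
  have hr' : 1 / 2 ≤ r := by nlinarith
  have hre' : (q / (1 - q)).re = (q.re - r ^ 2) / (1 - 2 * q.re + r ^ 2) := by
    rw [Complex.div_re, ← add_div]
    simp only [Complex.normSq_apply, sub_re, one_re, sub_im, one_im, zero_sub]
    congr 1
    · rw [hr]; ring
    · rw [hr]; ring
  have hpi : π ^ 2 < 10 := by nlinarith [Real.pi_lt_d2, Real.pi_pos]
  have hsq : (1 - r) ^ 2 ≤ 40 * y ^ 2 := by
    calc (1 - r) ^ 2 ≤ (2 * π * y) ^ 2 := by
          apply pow_le_pow_left₀ (by linarith) hqy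
      _ = 4 * π ^ 2 * y ^ 2 := by ring
      _ ≤ 40 * y ^ 2 := by nlinarith [sq_nonneg y]
  have hD : 1.1 * (1 - r) ^ 2 ≤ 1 - 2 * q.re + r ^ 2 := by
    nlinarith [mul_nonneg (sub_nonneg.2 hr') (sq_nonneg y)]
  have h1r : 0 < 1 - r := by linarith
  have hle : (q.re - r ^ 2) / (1 - 2 * q.re + r ^ 2) ≤ r * (1 - r) / (1.1 * (1 - r) ^ 2) := by
    refine div_le_div₀ (by positivity) ?_ (by positivity) hD
    nlinarith [mul_nonneg hr0 (sq_nonneg y)]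
  have e : r / (1 - r) - r * (1 - r) / (1.1 * (1 - r) ^ 2) = r / (11 * (1 - r)) := by
    field_simp
    ring
  rw [hre']
  calc 1 / (88 * π * y) ≤ r / (11 * (1 - r)) := by
        rw [div_le_div_iff₀ (by positivity) (by positivity)]
        nlinarith [Real.pi_pos, mul_pos Real.pi_pos hy]
    _ ≤ _ := by linarith

/-- The same loss of a proportion `1/11`, now from `|1 - q²|² = (1 - r²)² + 4 (Im q)²`. The constant
`88 = 2 · 11 · 4` comes from `r ≥ 1/2` and `1 - r² ≤ 4πy`. -/
lemma le_odd_geometric_sub_re {q : ℂ} {y : ℝ} (hy : 0 < y) (hq : ‖q‖ < 1)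
    (hqy : 1 - ‖q‖ ≤ 2 * π * y)
    (hq2 : 1 / 2 ≤ ‖q‖ ^ 2) (hre : q.re ≤ ‖q‖ * (1 - 8 * y ^ 2)) :
    1 / (88 * π * y) ≤ ‖q‖ / (1 - ‖q‖ ^ 2) - (q / (1 - q ^ 2)).re := by
  set r := ‖q‖
  have hr0 : 0 ≤ r := norm_nonneg q
  have hr : r ^ 2 = q.re ^ 2 + q.im ^ 2 := by
    rw [← Complex.normSq_eq_norm_sq, Complex.normSq_apply]
    ring
  have hr' : 1 / 2 ≤ r := by nlinarith
  have h1r : 0 < 1 - r ^ 2 := by nlinarith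
  have hqy2 : 1 - r ^ 2 ≤ 4 * π * y := by nlinarith
  have hre' : (q / (1 - q ^ 2)).re = q.re * (1 - r ^ 2) / ((1 - r ^ 2) ^ 2 + 4 * q.im ^ 2) := by
    rw [Complex.div_re, ← add_div]
    simp only [Complex.normSq_apply, sub_re, one_re, sub_im, one_im, zero_sub, pow_two, mul_re,
      mul_im]
    congr 1
    · rw [← pow_two r, hr]; ring
    · rw [← pow_two r, hr]; ring
  have hpi : π ^ 2 < 10 := by nlinarith [Real.pi_lt_d2, Real.pi_pos]
  have hsq : (1 - r ^ 2) ^ 2 ≤ 160 * y ^ 2 := by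
    calc (1 - r ^ 2) ^ 2 ≤ (4 * π * y) ^ 2 := by
          apply pow_le_pow_left₀ h1r.le hqy2
      _ = 16 * π ^ 2 * y ^ 2 := by ring
      _ ≤ 160 * y ^ 2 := by nlinarith [sq_nonneg y]
  have hle : q.re * (1 - r ^ 2) / ((1 - r ^ 2) ^ 2 + 4 * q.im ^ 2) ≤
      r * (1 - r ^ 2) / (1.1 * (1 - r ^ 2) ^ 2) := by
    -- Near `q = -1` the quotient is large in modulus but its real part is negative, so only `Re q >
    -- 0` needs a lower bound on `Im q`.
    rcases le_or_gt q.re 0 with h0 | h0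
    · refine (div_nonpos_of_nonpos_of_nonneg ?_ (by positivity)).trans (by positivity)
      exact mul_nonpos_of_nonpos_of_nonneg h0 h1r.le
    · have hle : q.re ≤ r := Complex.re_le_norm q
      have him : 8 * r ^ 2 * y ^ 2 ≤ q.im ^ 2 := by
        nlinarith [mul_nonneg hr0 (sub_nonneg.2 hre), mul_nonneg h0.le (sub_nonneg.2 hle)]
      refine div_le_div₀ (by positivity) ?_ (by positivity) ?_
      · exact mul_le_mul_of_nonneg_right hle h1r.le
      · nlinarith [mul_nonneg (sub_nonneg.2 hq2) (sq_nonneg y)]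
  have e : r / (1 - r ^ 2) - r * (1 - r ^ 2) / (1.1 * (1 - r ^ 2) ^ 2) =
      r / (11 * (1 - r ^ 2)) := by
    field_simp
    ring
  rw [hre']
  calc 1 / (88 * π * y) ≤ r / (11 * (1 - r ^ 2)) := by
        rw [div_le_div_iff₀ (by positivity) (by positivity)]
        nlinarith [Real.pi_pos, mul_pos Real.pi_pos hy]
    _ ≤ _ := by linarith

/-! ### Eta quotients and their modular transformations -/

/-- The nome as a function on `ℂ`. -/
def cnome (z : ℂ) : ℂ := cexp (2 * π * I * z)

lemma cnome_ne_zero (z : ℂ) : cnome z ≠ 0 := Complex.exp_ne_zero _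

lemma norm_cnome (z : ℂ) : ‖cnome z‖ = rexp (-(2 * π * z.im)) := by
  rw [cnome, Complex.norm_exp]
  simp

lemma norm_cnome_lt_one {z : ℂ} (hz : 0 < z.im) : ‖cnome z‖ < 1 := by
  rw [norm_cnome, Real.exp_lt_one_iff]
  have := Real.pi_pos
  simp only [Left.neg_neg_iff]
  positivity

/-- The Euler product `∏ (1 - q ^ (n + 1))`. -/
def eulerProd (q : ℂ) : ℂ := ∏' n : ℕ, (1 - q ^ (n + 1))

lemma eulerProd_ne_zero {z : ℂ} (hz : 0 < z.im) : eulerProd (cnome z) ≠ 0 := by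
  have := ModularForm.eta_tprod_ne_zero hz
  simpa only [ModularForm.eta_q_eq_pow, eulerProd, cnome] using this

lemma eta_pow_eq (z : ℂ) : ModularForm.eta z ^ 24 = cnome z * eulerProd (cnome z) ^ 24 := by
  simp only [ModularForm.eta, mul_pow, ModularForm.eta_q_eq_pow]
  congr 1
  rw [Function.Periodic.qParam, cnome, ← Complex.exp_nat_mul]
  congr 1
  push_cast
  ring

lemma cnome_two_mul (z : ℂ) : cnome (2 * z) = cnome z ^ 2 := by
  rw [cnome, cnome, ← Complex.exp_nat_mul]
  congr 1
  push_cast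
  ring

lemma norm_sq_lt_one {q : ℂ} (hq : ‖q‖ < 1) : ‖q ^ 2‖ < 1 := by
  rw [norm_pow]
  exact pow_lt_one₀ (norm_nonneg q) hq two_ne_zero

lemma eulerProd_mul_onePlusProd {q : ℂ} (hq : ‖q‖ < 1) :
    eulerProd q * onePlusProd (fun n => n + 1) q = eulerProd (q ^ 2) := by
  rw [eulerProd, onePlusProd, eulerProd, ← (ModularForm.multipliable_one_sub_pow hq).tprod_mul
    (multipliable_one_add_of_summable (summable_norm_pow (fun _ => le_rfl) hq))]
  exact tprod_congr fun n => by ring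

lemma eulerProd_eq_odd_mul {q : ℂ} (hq : ‖q‖ < 1) :
    eulerProd q = onePlusProd (fun n => 2 * n + 1) (-q) * eulerProd (q ^ 2) := by
  have hq' : ‖-q‖ < 1 := by rwa [norm_neg]
  have e1 : (fun k => 1 - q ^ (2 * k + 1)) = fun k => 1 + (-q) ^ (2 * k + 1) := by
    ext k
    rw [Odd.neg_pow ⟨k, rfl⟩, sub_eq_add_neg]
  have e2 : (fun k => 1 - q ^ (2 * k + 1 + 1)) = fun k => 1 - (q ^ 2) ^ (k + 1) := by
    ext k
    ring
  have h1 : Multipliable fun k => 1 - q ^ (2 * k + 1) := by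
    rw [e1]
    exact multipliable_one_add_of_summable (summable_norm_pow (fun _ => by omega) hq')
  have h2 : Multipliable fun k => 1 - q ^ (2 * k + 1 + 1) := by
    rw [e2]
    exact ModularForm.multipliable_one_sub_pow (norm_sq_lt_one hq)
  have := tprod_even_mul_odd (f := fun n => 1 - q ^ (n + 1)) h1 h2
  rw [e1, e2] at this
  exact this.symm

/-- The function `ψ` on `ℂ`. -/
def cpsi (z : ℂ) : ℂ := (ModularForm.eta z / ModularForm.eta (2 * z)) ^ 24

/-- The function `q⁻¹ ∏ (1 + q ^ (2 n + 1)) ^ 24`, a translate of `-ψ`. -/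
def gfun (z : ℂ) : ℂ := (cnome z)⁻¹ * onePlusProd (fun n => 2 * n + 1) (cnome z) ^ 24

/-- The function `q ∏ (1 + q ^ (n + 1)) ^ 24`. -/
def cphi (z : ℂ) : ℂ := cnome z * onePlusProd (fun n => n + 1) (cnome z) ^ 24

lemma two_mul_im_pos {z : ℂ} (hz : 0 < z.im) : 0 < (2 * z).im := by simpa using hz

lemma cpsi_eq {z : ℂ} (hz : 0 < z.im) :
    cpsi z = (cnome z)⁻¹ * onePlusProd (fun n => 2 * n + 1) (-cnome z) ^ 24 := by
  have h1 := eulerProd_ne_zero (two_mul_im_pos hz)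
  have h2 := cnome_ne_zero z
  rw [cnome_two_mul] at h1
  rw [cpsi, div_pow, eta_pow_eq, eta_pow_eq, cnome_two_mul,
    eulerProd_eq_odd_mul (norm_cnome_lt_one hz)]
  field_simp

lemma inv_cpsi_eq {z : ℂ} (hz : 0 < z.im) : (cpsi z)⁻¹ = cphi z := by
  have h1 := eulerProd_ne_zero hz
  have h2 := cnome_ne_zero z
  rw [cpsi, div_pow, eta_pow_eq, eta_pow_eq, cnome_two_mul, cphi, inv_div,
    ← eulerProd_mul_onePlusProd (norm_cnome_lt_one hz)]
  field_simp

lemma cnome_add_half (z : ℂ) : cnome (z + 1 / 2) = -cnome z := by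
  rw [cnome, cnome, show 2 * π * I * (z + 1 / 2) = 2 * π * I * z + π * I by ring,
    Complex.exp_add, Complex.exp_pi_mul_I]
  ring

lemma cpsi_add_half {z : ℂ} (hz : 0 < z.im) : cpsi (z + 1 / 2) = -gfun z := by
  rw [cpsi_eq (by simpa using hz), cnome_add_half, neg_neg, inv_neg, gfun, neg_mul]

lemma cnome_add_one (z : ℂ) : cnome (z + 1) = cnome z := by
  rw [show z + 1 = z + 1 / 2 + 1 / 2 by ring, cnome_add_half, cnome_add_half, neg_neg]

lemma im_neg_inv_pos {z : ℂ} (hz : 0 < z.im) : 0 < (-1 / z).im := by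
  have h : z ≠ 0 := fun h => by simp [h] at hz
  rw [neg_div, one_div, neg_im, inv_im, neg_div, neg_neg]
  exact div_pos hz (normSq_pos.2 h)

/-- This is the weight 12 invariance of the discriminant under `S`; the 24th power avoids any choice
of square root. -/
lemma eta_neg_inv_pow {z : ℂ} (hz : 0 < z.im) :
    ModularForm.eta (-1 / z) ^ 24 = z ^ 12 * ModularForm.eta z ^ 24 := by
  have h0 : z ≠ 0 := fun h => by simp [h] at hz
  have h := congrFun ModularForm.discriminant_S_invariant (⟨z, hz⟩ : ℍ)
  rw [ModularForm.SL_slash_apply, UpperHalfPlane.modular_S_smul, ModularGroup.denom_S] at h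
  simp [ModularForm.discriminant] at h
  rw [neg_div, one_div, ← h]
  field_simp

/-- The factor `4096 = 2^12` is the ratio of the automorphy factors `(2z)^12` and `z^12`. -/
lemma cphi_eq_cpsi {z : ℂ} (hz : 0 < z.im) : cphi z = 1 / 4096 * cpsi (-1 / (2 * z)) := by
  have h0 : z ≠ 0 := fun h => by simp [h] at hz
  have e : 2 * (-1 / (2 * z)) = -1 / z := by field_simp
  have h1 := ModularForm.eta_ne_zero hz
  rw [← inv_cpsi_eq hz, cpsi, cpsi, e, div_pow, div_pow, eta_neg_inv_pow hz,
    eta_neg_inv_pow (two_mul_im_pos hz)]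
  have h2 := ModularForm.eta_ne_zero (two_mul_im_pos hz)
  field_simp
  norm_num

lemma cpsi_eq_cphi {z : ℂ} (hz : 0 < z.im) : cpsi z = 4096 * cphi (-1 / (2 * z)) := by
  have h0 : z ≠ 0 := fun h => by simp [h] at hz
  rw [cphi_eq_cpsi (im_neg_inv_pos (two_mul_im_pos hz)),
    show -1 / (2 * (-1 / (2 * z))) = z by field_simp]
  ring

lemma cphi_add_one (z : ℂ) : cphi (z + 1) = cphi z := by
  rw [cphi, cnome_add_one, cphi]

lemma cpsi_add_one {z : ℂ} (hz : 0 < z.im) : cpsi (z + 1) = cpsi z := by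
  rw [cpsi_eq hz, cpsi_eq (by simpa using hz), cnome_add_one]

/-- Conjugating by the half translation, both sides become values of `cphi` through `cpsi_eq_cphi`.
Their arguments `2z/(2z + 1)` and `-1/(2z + 1)` differ by `1`. -/
lemma gfun_neg_inv {z : ℂ} (hz : 0 < z.im) : gfun (-1 / (4 * z)) = gfun z := by
  have h0 : z ≠ 0 := fun h => by simp [h] at hz
  have h4 : 0 < (-1 / (4 * z)).im := im_neg_inv_pos (by simpa using hz)
  have hh : 0 < (z + 1 / 2).im := by simpa using hz
  have hh0 : 2 * (z + 1 / 2) ≠ 0 := fun h => by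
    have := congrArg Complex.im h
    simp at this
    exact hz.ne' this
  have hw : 0 < (-1 / (4 * z) - 1 / 2).im := by simpa using h4
  rw [← neg_inj, ← cpsi_add_half hz, ← cpsi_add_half h4, cpsi_eq_cphi hh,
    show -1 / (4 * z) + 1 / 2 = (-1 / (4 * z) - 1 / 2) + 1 by ring, cpsi_add_one hw,
    cpsi_eq_cphi hw, ← cphi_add_one (-1 / (2 * (z + 1 / 2)))]
  congr 2
  have h5 : 2 * z + 1 ≠ 0 := by
    convert hh0 using 1
    ring
  rw [show 2 * (z + 1 / 2) = 2 * z + 1 by ring,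
    show 2 * (-1 / (4 * z) - 1 / 2) = -(2 * z + 1) / (2 * z) by field_simp; ring]
  field_simp
  ring

/-! ### Size near the cusp and on the rest of the period -/

lemma exists_bound_cpsi_gfun : ∃ C : ℝ, 0 ≤ C ∧ ∀ z : ℂ, 1 ≤ z.im →
    ‖cpsi z - (cnome z)⁻¹‖ ≤ C ∧ ‖gfun z - (cnome z)⁻¹‖ ≤ C := by
  obtain ⟨C, hC0, hC⟩ := ((hasIntegralSeries_onePlusProd (m := fun n => 2 * n + 1)
    (fun _ => by omega) rfl).pow 24).exists_bound
  refine ⟨C, hC0, fun z hz => ?_⟩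
  have hn : ‖cnome z‖ ≤ 1 / 2 := by
    rw [norm_cnome, Real.exp_neg, inv_le_comm₀ (Real.exp_pos _) (by norm_num)]
    have := Real.add_one_le_exp (2 * π * z.im)
    nlinarith [Real.pi_gt_three]
  constructor
  · have := hC (-cnome z) (neg_ne_zero.2 (cnome_ne_zero z)) (by rwa [norm_neg])
    rw [cpsi_eq (by linarith), ← norm_neg]
    refine le_trans (le_of_eq (congrArg _ ?_)) this
    rw [inv_neg]
    ring
  · exact hC _ (cnome_ne_zero z) hn

/-- Near the imaginary axis, points of small height are mapped high up by `z ↦ -1 / (k z)`. -/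
lemma one_le_im_neg_inv {x y k : ℝ} (hk : 0 < k) (hy : 0 < y) (hx : |x| ≤ y)
    (hky : 2 * k * y ≤ 1) : 1 ≤ (-1 / (k * (x + y * I)) : ℂ).im := by
  have h : (-1 / (k * (x + y * I)) : ℂ).im = k * y / (k * (k * (x ^ 2 + y ^ 2))) := by
    rw [neg_div, one_div, neg_im, inv_im, neg_div, neg_neg]
    simp [Complex.normSq_apply]
    ring
  have hx2 : x ^ 2 ≤ y ^ 2 := sq_le_sq' (abs_le.1 hx).1 (abs_le.1 hx).2
  rw [h, le_div_iff₀ (by positivity), one_mul]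
  refine mul_le_mul_of_nonneg_left ?_ hk.le
  nlinarith

lemma inv_cnome_neg_inv (k z : ℂ) :
    (cnome (-1 / (k * z)))⁻¹ = cexp (2 * π * I * k⁻¹ / z) := by
  rw [cnome, ← Complex.exp_neg]
  congr 1
  rw [neg_div, one_div, mul_inv]
  ring

lemma exists_major_bound : ∃ B : ℝ, 0 ≤ B ∧ ∀ x y : ℝ, 0 < y → |x| ≤ y → y ≤ 1 / 8 →
    ‖cphi (x + y * I) - (1 / 4096 : ℝ) * cexp (2 * π * I * (1 / 2 : ℝ) / (x + y * I))‖ ≤ B ∧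
    ‖gfun (x + y * I) - cexp (2 * π * I * (1 / 4 : ℝ) / (x + y * I))‖ ≤ B := by
  obtain ⟨C, hC0, hC⟩ := exists_bound_cpsi_gfun
  refine ⟨C, hC0, fun x y hy hx hy8 => ?_⟩
  have hz : 0 < (x + y * I : ℂ).im := by simpa using hy
  constructor
  · have h1 := (hC _ (one_le_im_neg_inv two_pos hy hx (by linarith))).1
    rw [inv_cnome_neg_inv] at h1
    push_cast at h1 ⊢
    rw [cphi_eq_cpsi hz, ← mul_sub, norm_mul, one_div (2 : ℂ)]
    refine (mul_le_of_le_one_left (norm_nonneg _) (by norm_num)).trans h1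
  · have h1 := (hC _ (one_le_im_neg_inv four_pos hy hx (by linarith))).2
    rw [inv_cnome_neg_inv] at h1
    push_cast at h1 ⊢
    rw [gfun_neg_inv hz] at h1
    rwa [one_div (4 : ℂ)]

lemma re_cnome_le {x y : ℝ} (hy : 0 < y) (hx : y ≤ |x|) (hx2 : |x| ≤ 1 / 2) :
    (cnome (x + y * I)).re ≤ ‖cnome (x + y * I)‖ * (1 - 8 * y ^ 2) := by
  have h1 : (cnome (x + y * I)).re = ‖cnome (x + y * I)‖ * Real.cos (2 * π * x) := by
    rw [norm_cnome, cnome, Complex.exp_re]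
    simp
  rw [h1]
  refine mul_le_mul_of_nonneg_left ?_ (norm_nonneg _)
  have hc := Real.cos_le_one_sub_mul_cos_sq (x := 2 * π * x) (by
    rw [abs_mul, abs_of_pos (by positivity : 0 < 2 * π)]
    nlinarith [Real.pi_pos])
  -- The bound `cos θ ≤ 1 - 2θ²/π²` on `|θ| ≤ π`, at `θ = 2πx`, produces `8x²`.
  refine hc.trans ?_
  have e : 2 / π ^ 2 * (2 * π * x) ^ 2 = 8 * |x| ^ 2 := by
    rw [sq_abs]
    field_simp
    ring
  rw [e]
  have := pow_le_pow_left₀ hy.le hx 2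
  linarith

lemma norm_onePlusProd_cnome_le {m : ℕ → ℕ} (hm : ∀ i, i + 1 ≤ m i) {x y : ℝ} (hy : 0 < y)
    (h : 1 / (88 * π * y) ≤
      (∑' n, ‖cnome (x + y * I)‖ ^ m n) - (∑' n, cnome (x + y * I) ^ m n).re) :
    ‖onePlusProd m (cnome (x + y * I))‖ ^ 24 ≤
      ‖onePlusProd m (cnome (y * I))‖ ^ 24 * rexp (-(1 / 50) / y) := by
  have hz : 0 < (x + y * I : ℂ).im := by simpa using hy
  have h1 := norm_onePlusProd_le hm (norm_cnome_lt_one hz)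
  have e : (‖cnome (x + y * I)‖ : ℂ) = cnome (y * I) := by
    rw [norm_cnome, cnome, Complex.ofReal_exp]
    congr 1
    simp
    linear_combination (-2 * π * y : ℂ) * I_sq
  rw [e] at h1
  refine (pow_le_pow_left₀ (norm_nonneg _) h1 24).trans ?_
  rw [mul_pow, ← Real.exp_nat_mul]
  refine mul_le_mul_of_nonneg_left (Real.exp_le_exp.2 ?_) (by positivity)
  -- The 24th power turns the rate `1/4` into `6`, and `6/(88π) > 1/50`.
  have h2 : 1 / 50 / y ≤ 6 * (1 / (88 * π * y)) := by
    rw [div_div, mul_one_div, div_le_div_iff₀ (by positivity) (by positivity)]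
    nlinarith [Real.pi_lt_d2]
  rw [neg_div]
  push_cast
  linarith

lemma norm_exp_div_mul_I (k y : ℝ) : ‖cexp (2 * π * I * k / (y * I))‖ = rexp (2 * π * k / y) := by
  have : (2 * π * I * k / (y * I) : ℂ) = (2 * π * k / y : ℝ) := by
    push_cast
    rw [mul_right_comm, mul_div_mul_right _ _ I_ne_zero]
  rw [this, ← Complex.ofReal_exp, Complex.norm_real, Real.norm_of_nonneg (Real.exp_pos _).le]

lemma norm_cnome_add (x y : ℝ) : ‖cnome (x + y * I)‖ = ‖cnome (y * I)‖ := by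
  rw [norm_cnome, norm_cnome]
  simp

/-- The value at `x + iy` is compared with the value at `iy`, whose size is given by the major-arc
bound. The condition `y ≤ 1/40` secures `|q|² ≥ 1/2`. -/
lemma exists_minor_bound : ∃ C : ℝ, ∀ x y : ℝ, 0 < y → y ≤ 1 / 40 → y ≤ |x| → |x| ≤ 1 / 2 →
    ‖cphi (x + y * I)‖ ≤ C * rexp ((2 * π * (1 / 2) - 1 / 50) / y) ∧
    ‖gfun (x + y * I)‖ ≤ C * rexp ((2 * π * (1 / 4) - 1 / 50) / y) := by
  obtain ⟨B, hB0, hB⟩ := exists_major_bound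
  refine ⟨B + 1, fun x y hy hy40 hx hx2 => ?_⟩
  have hz : 0 < (x + y * I : ℂ).im := by simpa using hy
  have hq := norm_cnome_lt_one hz
  have hr : ‖cnome (x + y * I)‖ = rexp (-(2 * π * y)) := by
    rw [norm_cnome, im_add_mul_I]
  have hqy : 1 - ‖cnome (x + y * I)‖ ≤ 2 * π * y := by
    rw [hr]
    linarith [Real.add_one_le_exp (-(2 * π * y))]
  have hq2 : 1 / 2 ≤ ‖cnome (x + y * I)‖ ^ 2 := by
    rw [hr, ← Real.exp_nat_mul]
    have := Real.add_one_le_exp (((2 : ℕ) : ℝ) * (-(2 * π * y)))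
    push_cast at this ⊢
    nlinarith [Real.pi_lt_d2]
  have hre := re_cnome_le hy hx hx2
  have hq' : ‖‖cnome (x + y * I)‖‖ < 1 := by rwa [norm_norm]
  obtain ⟨h1, h2⟩ := hB 0 y hy (by rw [abs_zero]; exact hy.le) (by linarith)
  simp only [ofReal_zero, zero_add] at h1 h2
  have bound : ∀ {u v : ℂ} {k : ℝ}, 0 < k → ‖v‖ ≤ rexp (2 * π * k / y) → ‖u - v‖ ≤ B →
      ‖u‖ * rexp (-(1 / 50) / y) ≤ (B + 1) * rexp ((2 * π * k - 1 / 50) / y) := by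
    intro u v k hk hv huv
    have he : 1 ≤ rexp (2 * π * k / y) := Real.one_le_exp (by positivity)
    have hu : ‖u‖ ≤ (B + 1) * rexp (2 * π * k / y) := by
      have := norm_le_norm_add_norm_sub' u v
      nlinarith
    rw [sub_eq_add_neg, add_div, Real.exp_add, ← mul_assoc]
    exact mul_le_mul_of_nonneg_right hu (Real.exp_pos _).le
  constructor
  · have := norm_onePlusProd_cnome_le (m := fun n => n + 1) (fun _ => le_rfl) (x := x) hy (by
      rw [tsum_pow_succ hq, tsum_pow_succ hq']
      exact le_geometric_sub_re hy hq hqy hq2 hre)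
    refine le_trans ?_ (bound (by norm_num) ?_ h1)
    · rw [cphi, cphi, norm_mul, norm_mul, norm_pow, norm_pow, norm_cnome_add, mul_assoc]
      exact mul_le_mul_of_nonneg_left this (norm_nonneg _)
    · rw [norm_mul, norm_exp_div_mul_I]
      exact mul_le_of_le_one_left (Real.exp_pos _).le (by rw [Complex.norm_real]; norm_num)
  · have := norm_onePlusProd_cnome_le (m := fun n => 2 * n + 1) (fun _ => by omega) (x := x) hy (by
      rw [tsum_pow_odd hq, tsum_pow_odd hq']
      exact le_odd_geometric_sub_re hy hq hqy hq2 hre)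
    refine le_trans ?_ (bound (by norm_num) (norm_exp_div_mul_I _ _).le h2)
    rw [gfun, gfun, norm_mul, norm_mul, norm_pow, norm_pow, norm_inv, norm_inv, norm_cnome_add,
      mul_assoc]
    exact mul_le_mul_of_nonneg_left this (by positivity)

/-! ### The expansions and the asymptotics of their coefficients -/

lemma eventually_pos_le {δ : ℝ} (hδ : 0 < δ) : ∀ᶠ y : ℝ in 𝓝[>] 0, 0 < y ∧ y ≤ δ := by
  filter_upwards [self_mem_nhdsWithin, nhdsWithin_le_nhds (Iic_mem_nhds hδ)] with y h1 h2
  exact ⟨h1, h2⟩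

lemma phi_eq (z : ℍ) : phi z = cphi z := by
  rw [← inv_cpsi_eq z.2, phi, one_div]
  rfl

lemma nome_eq (z : ℍ) : nome z = cnome z := rfl

lemma psi_eq (z : ℍ) : psi z = cpsi z := rfl

lemma exists_isPsiExpansion : ∃ s : ℕ → ℤ, IsPsiExpansion fun n => (s n : ℂ) := by
  obtain ⟨a, a0, a1, ha⟩ := (hasIntegralSeries_onePlusProd (m := fun n => 2 * n + 1)
    (fun _ => by omega) rfl).pow 24
  -- The product is evaluated at `-q` and multiplied by `q⁻¹`, which gives the sign and the shift.
  -- The two terms removed below are `q⁻¹` and `-24`, as `a 1 = 24`.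
  refine ⟨fun n => (-1) ^ (n + 1) * a (n + 1), fun z => ?_⟩
  have hq : ‖-cnome z‖ < 1 := by
    rw [norm_neg]
    exact norm_cnome_lt_one z.2
  have h := ((hasSum_nat_add_iff' 2).2 (ha _ hq)).mul_left (cnome z)⁻¹
  have h0 := cnome_ne_zero z
  refine (congrArg₂ HasSum (funext fun n => ?_) ?_).mpr h
  · rw [nome_eq, neg_pow (cnome z)]
    push_cast
    field_simp
    ring
  · rw [psi_eq, nome_eq, cpsi_eq z.2]
    simp only [Finset.sum_range_succ, Finset.range_zero, Finset.sum_empty, a0, a1]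
    push_cast
    field_simp
    ring

lemma exists_isPhiExpansion : ∃ b : ℕ → ℤ, IsPhiExpansion fun n => (b n : ℂ) := by
  obtain ⟨a, -, -, ha⟩ := (hasIntegralSeries_onePlusProd (m := fun n => n + 1)
    (fun _ => le_rfl) rfl).pow 24
  refine ⟨fun n => a (n - 1), fun z => ?_⟩
  have h := (ha _ (norm_cnome_lt_one z.2)).mul_left (cnome z)
  rw [phi_eq, cphi]
  refine (congrArg (HasSum · _) (funext fun n => ?_)).mpr h
  simp only [nome_eq, Nat.add_sub_cancel]
  ring

lemma hasSum_update_zero {a : ℕ → ℂ} {q v : ℂ}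
    (h : HasSum (fun n => a (n + 1) * q ^ (n + 1)) v) :
    HasSum (fun n => Function.update a 0 0 n * q ^ n) v := by
  rw [← hasSum_nat_add_iff' 1]
  simpa using h

lemma update_zero_eventuallyEq (a : ℕ → ℂ) : Function.update a 0 0 =ᶠ[atTop] a := by
  filter_upwards [eventually_ne_atTop 0] with n hn
  exact Function.update_of_ne hn _ _

lemma isEquivalent_norm {u v : ℕ → ℂ} (h : Asymptotics.IsEquivalent atTop u v) :
    Asymptotics.IsEquivalent atTop (fun n => ‖u n‖) (fun n => ‖v n‖) :=
  (Asymptotics.IsBigO.of_norm_le fun n => abs_norm_sub_norm_le (u n) (v n)).trans_isLittleO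
    h.isLittleO.norm_right.norm_left

theorem isEquivalent_phi_coeff {b : ℕ → ℂ} (hb : IsPhiExpansion b) :
    Asymptotics.IsEquivalent atTop b
      (fun n : ℕ => (((2 : ℝ) ^ (1 / 4 : ℝ) / 8192 * (1 / (n : ℝ) ^ (3 / 4 : ℝ)) *
          Real.exp (2 * Real.pi * Real.sqrt (2 * (n : ℝ))) : ℝ) : ℂ)) := by
  have hF : ∀ z : ℂ, 0 < z.im →
      HasSum (fun n => Function.update b 0 0 n * cexp (2 * π * I * z) ^ n) (cphi z) := by
    intro z hz
    have := hb ⟨z, hz⟩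
    rw [phi_eq] at this
    exact hasSum_update_zero this
  obtain ⟨B, hB0, hB⟩ := exists_major_bound
  obtain ⟨C, hC⟩ := exists_minor_bound
  have key := isEquivalent_coeff hF (A := 1 / 4096) (κ := 1 / 2) (B := B) (C := C) (c := 1 / 50)
    (by norm_num) (by norm_num) (by norm_num)
    ((eventually_pos_le (δ := 1 / 8) (by norm_num)).mono fun y hy x hx =>
      (hB x y hy.1 hx hy.2).1)
    ((eventually_pos_le (δ := 1 / 40) (by norm_num)).mono fun y hy x hx hx2 =>
      (hC x y hy.1 hy.2 hx hx2).1)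
  refine (key.congr_left (update_zero_eventuallyEq b)).congr_right (.of_forall fun n => ?_)
  refine congrArg ofReal ?_
  have h2 : √(2 * (n : ℝ)) = 2 * √(1 / 2 * n) := by
    rw [show (2 * n : ℝ) = 2 ^ 2 * (1 / 2 * n) by ring, Real.sqrt_mul (by norm_num),
      Real.sqrt_sq (by norm_num)]
  have h3 : (1 / 2 : ℝ) ^ (1 / 4 : ℝ) = 2 ^ (1 / 4 : ℝ) / √2 := by
    rw [Real.sqrt_eq_rpow, ← Real.rpow_sub two_pos, one_div, Real.inv_rpow two_pos.le,
      ← Real.rpow_neg two_pos.le]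
    norm_num
  rw [h2, h3, show 2 * π * (2 * √(1 / 2 * n)) = 4 * π * √(1 / 2 * n) by ring]
  congr 1
  have hs' : √2 ^ 2 = 2 := Real.sq_sqrt two_pos.le
  field_simp
  rw [hs']
  norm_num

theorem isEquivalent_norm_psi_coeff {s : ℕ → ℂ} (hs : IsPsiExpansion s) :
    Asymptotics.IsEquivalent atTop (fun n : ℕ => ‖s n‖)
      (fun n : ℕ => 1 / (2 * (n : ℝ) ^ (3 / 4 : ℝ)) *
          Real.exp (2 * Real.pi * Real.sqrt (n : ℝ))) := by
  -- These are the coefficients of `g - q⁻¹ - 24`, since `z ↦ z + 1/2` sends `q` to `-q`.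
  set a : ℕ → ℂ := fun n => -((-1) ^ n * s n) with ha
  have hF : ∀ z : ℂ, 0 < z.im →
      HasSum (fun n => Function.update a 0 0 n * cexp (2 * π * I * z) ^ n)
        (gfun z - (cnome z)⁻¹ - 24) := by
    intro z hz
    have hz' : 0 < (z + 1 / 2).im := by simpa using hz
    have h := (hs ⟨z + 1 / 2, hz'⟩).neg
    rw [psi_eq, nome_eq] at h
    simp only [cpsi_add_half hz, cnome_add_half] at h
    refine hasSum_update_zero ((congrArg₂ HasSum (funext fun n => ?_) ?_).mpr h)
    · change _ * cnome z ^ (n + 1) = _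
      rw [neg_pow (cnome z)]
      ring
    · rw [inv_neg]
      ring
  obtain ⟨B, hB0, hB⟩ := exists_major_bound
  obtain ⟨C, hC⟩ := exists_minor_bound
  have hinv : ∀ x y : ℝ, 0 < y → y ≤ 1 / 40 → ‖(cnome (x + y * I))⁻¹‖ ≤ 2 := by
    intro x y hy hy40
    rw [norm_inv, norm_cnome, im_add_mul_I, inv_le_comm₀ (Real.exp_pos _) two_pos]
    have := Real.add_one_le_exp (-(2 * π * y))
    nlinarith [Real.pi_lt_d2]
  -- The extra `26 = 2 + 24` bounds the subtracted `q⁻¹ + 24` at small height.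
  have key := isEquivalent_coeff hF (A := 1) (κ := 1 / 4) (B := B + 26) (C := C + 26)
    (c := 1 / 50) one_ne_zero (by norm_num) (by norm_num)
    ((eventually_pos_le (δ := 1 / 40) (by norm_num)).mono fun y hy x hx => by
      have h1 := (hB x y hy.1 hx (by linarith [hy.2])).2
      have h2 := hinv x y hy.1 hy.2
      rw [ofReal_one, one_mul, sub_sub (gfun _), sub_right_comm]
      refine (norm_sub_le _ _).trans (add_le_add h1 ((norm_add_le _ _).trans ?_))
      rw [show ‖(24 : ℂ)‖ = 24 by norm_num]
      linarith)
    ((eventually_pos_le (δ := 1 / 40) (by norm_num)).mono fun y hy x hx hx2 => by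
      have h1 := (hC x y hy.1 hy.2 hx hx2).2
      have h2 := hinv x y hy.1 hy.2
      have h3 : 1 ≤ rexp ((2 * π * (1 / 4) - 1 / 50) / y) :=
        Real.one_le_exp (div_nonneg (by linarith [Real.pi_gt_three]) hy.1.le)
      rw [sub_sub, add_mul]
      refine (norm_sub_le _ _).trans (add_le_add h1 ((norm_add_le _ _).trans ?_))
      rw [show ‖(24 : ℂ)‖ = 24 by norm_num]
      linarith)
  have key2 := isEquivalent_norm (key.congr_left (update_zero_eventuallyEq a))
  refine (key2.congr_left (.of_forall fun n => ?_)).congr_right (.of_forall fun n => ?_)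
  · simp [ha]
  · have h2 : √(n : ℝ) = 2 * √(1 / 4 * n) := by
      rw [show (n : ℝ) = 2 ^ 2 * (1 / 4 * n) by ring, Real.sqrt_mul (by norm_num),
        Real.sqrt_sq (by norm_num)]
      ring_nf
    have h3 : (1 / 4 : ℝ) ^ (1 / 4 : ℝ) = 1 / √2 := by
      rw [show (1 / 4 : ℝ) = 2 ^ (-2 : ℝ) by norm_num [Real.rpow_neg], ← Real.rpow_mul two_pos.le,
        Real.sqrt_eq_rpow, one_div, ← Real.rpow_neg two_pos.le]
      norm_num
    simp only
    rw [Complex.norm_real, Real.norm_of_nonneg (by positivity), h2, h3,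
      show 2 * π * (2 * √(1 / 4 * n)) = 4 * π * √(1 / 4 * n) by ring]
    congr 1
    have hs : √2 * √2 = 2 := Real.mul_self_sqrt two_pos.le
    rw [one_mul, div_div, ← mul_assoc, hs]

end LevelTwo
end

theorem theorem2 :
    -- the expansions exist, with integer coefficients
    (∃ s : ℕ → ℤ, LevelTwo.IsPsiExpansion (fun n => (s n : ℂ))) ∧
    (∃ b : ℕ → ℤ, LevelTwo.IsPhiExpansion (fun n => (b n : ℂ))) ∧
    -- the asymptotic formula for the coefficients of `ψ`
    (∀ s : ℕ → ℂ, LevelTwo.IsPsiExpansion s →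
      Asymptotics.IsEquivalent Filter.atTop (fun n : ℕ => ‖s n‖)
        (fun n : ℕ => 1 / (2 * (n : ℝ) ^ (3 / 4 : ℝ)) *
          Real.exp (2 * Real.pi * Real.sqrt (n : ℝ)))) ∧
    -- the asymptotic formula for the coefficients of `φ`
    (∀ b : ℕ → ℂ, LevelTwo.IsPhiExpansion b →
      Asymptotics.IsEquivalent Filter.atTop b
        (fun n : ℕ => (((2 : ℝ) ^ (1 / 4 : ℝ) / 8192 * (1 / (n : ℝ) ^ (3 / 4 : ℝ)) *
          Real.exp (2 * Real.pi * Real.sqrt (2 * (n : ℝ))) : ℝ) : ℂ))) :=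
  ⟨LevelTwo.exists_isPsiExpansion, LevelTwo.exists_isPhiExpansion,
    fun _ hs => LevelTwo.isEquivalent_norm_psi_coeff hs,
    fun _ hb => LevelTwo.isEquivalent_phi_coeff hb⟩
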